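/- Let $R$ be a commutative artinian ring and $\Lambda$ an Artin $R$-algebra, i.e. an $R$-algebra that is finitely generated as an $R$-module. Let $\mathrm{mod}\text{-}\Lambda$ be the category of finitely presented right $\Lambda$-modules, and let $\mathcal X\subseteq \mathrm{mod}\text{-}\Lambda$ be a full subcategory that contains all finitely generated projective modules and is contravariantly finite (every $M\in\mathrm{mod}\text{-}\Lambda$ admits a morphism $X\to M$ with $X\in\mathcal X$ through which every morphism from an object of $\mathcal X$ to $M$ factors). Let $\mathrm{mod}\text{-}\mathcal X$ be the abelian category of finitely presented $\mathcal X$-modules: the additive functors $F:\mathcal X^{op}\to \mathcal{A}b$ that admit an exact sequence $\mathcal X(-,X_1)\xrightarrow{(-,d)}\mathcal X(-,X_0)\to F\to 0$ with $X_0,X_1\in\mathcal X$. Let $\vartheta:\mathrm{mod}\text{-}\mathcal X\to \mathrm{mod}\text{-}\Lambda$ be the exact functor given on objects by $\vartheta(F)=\mathrm{Coker}(d:X_1\to X_0)$ and on morphisms by lifting to presentations. For an abelian category $\mathcal A$ let $\mathbb K^b(\mathcal A)$ be the homotopy category of bounded complexes, $\mathbb K^b_{ac}(\mathcal A)$ its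 full subcategory of acyclic complexes, and $\mathbb D^b(\mathcal A)=\mathbb K^b(\mathcal A)/\mathbb K^b_{ac}(\mathcal A)$ (Verdier quotient). Let $\mathbb D^b_\vartheta:\mathbb D^b(\mathrm{mod}\text{-}\mathcal X)\to\mathbb D^b(\mathrm{mod}\text{-}\Lambda)$ be the triangle functor that applies $\vartheta$ term by term, and let $\mathbb D^b_0(\mathrm{mod}\text{-}\mathcal X)$ be its kernel, the full subcategory of the objects that $\mathbb D^b_\vartheta$ sends to zero objects. Let $\mathbb K^b_{\Lambda\text{-}ac}(\mathrm{mod}\text{-}\mathcal X)\subseteq\mathbb K^b(\mathrm{mod}\text{-}\mathcal X)$ be the full subcategory of the complexes $\mathbf F$ such that the complex $\mathbf F(\Lambda)$ of abelian groups is acyclic; it is a triangulated subcategory that contains $\mathbb K^b_{ac}(\mathrm{mod}\text{-}\mathcal X)$. Then there is an equivalence of triangulated categories $$\mathbb K^b_{\Lambda\text{-}ac}(\mathrm{mod}\text{-}\mathcal X)\,/\,\mathbb K^b_{ac}(\mathrm{mod}\text{-}\mathcal X)\;\simeq\;\mathbb D^b_0(\mathrm{mod}\text{-}\mathcal X),$$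 which is induced by the inclusion $\mathbb K^b_{\Lambda\text{-}ac}(\mathrm{mod}\text{-}\mathcal X)\subseteq\mathbb K^b(\mathrm{mod}\text{-}\mathcal X)$: composed with the quotient functor from $\mathbb K^b_{\Lambda\text{-}ac}(\mathrm{mod}\text{-}\mathcal X)$ and with the inclusion of $\mathbb D^b_0(\mathrm{mod}\text{-}\mathcal X)$ in $\mathbb D^b(\mathrm{mod}\text{-}\mathcal X)$, it is isomorphic, compatibly with the shifts, to the restriction of the canonical functor $\mathbb K^b(\mathrm{mod}\text{-}\mathcal X)\to\mathbb D^b(\mathrm{mod}\text{-}\mathcal X)$. -/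

import Mathlib

open CategoryTheory CategoryTheory.Limits CategoryTheory.Pretriangulated ZeroObject

noncomputable section

namespace DerivedAuslander

universe v₁ v₂ u₁ u₂

section Bounded

variable (A : Type u₁) [Category.{v₁} A] [Abelian A]
variable (B : Type u₂) [Category.{v₂} B] [Abelian B]

/-- The objects of the homotopy category that are bounded complexes. -/
def boundedComplexes : ObjectProperty (HomotopyCategory A (ComplexShape.up ℤ)) :=
  fun K => ∃ a b : ℤ, CochainComplex.IsStrictlyGE K.as a ∧ CochainComplex.IsStrictlyLE K.as b

variable {A} in
theorem boundedComplexes_mappingCone {K L : CochainComplex A ℤ} (f : K ⟶ L)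
    (hK : boundedComplexes A ((HomotopyCategory.quotient _ _).obj K))
    (hL : boundedComplexes A ((HomotopyCategory.quotient _ _).obj L)) :
    boundedComplexes A
      ((HomotopyCategory.quotient _ _).obj (CochainComplex.mappingCone f)) := by
  obtain ⟨a, b, h₁, h₂⟩ := hK
  obtain ⟨a', b', h₁', h₂'⟩ := hL
  change CochainComplex.IsStrictlyGE K a at h₁
  change CochainComplex.IsStrictlyLE K b at h₂
  change CochainComplex.IsStrictlyGE L a' at h₁'
  change CochainComplex.IsStrictlyLE L b' at h₂'
  refine ⟨min (a - 1) a', max b b', ?_, ?_⟩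
  · exact CochainComplex.isStrictlyGE_mappingCone f a a' _
      (by have := min_le_left (a - 1) a'; omega) (min_le_right _ _)
  · change CochainComplex.IsStrictlyLE (CochainComplex.mappingCone f) _
    rw [CochainComplex.isStrictlyLE_iff]
    intro i hi
    have := le_max_left b b'
    have := le_max_right b b'
    rw [CochainComplex.mappingCone.isZero_X_iff]
    exact ⟨K.isZero_of_isStrictlyLE b _ (by omega), L.isZero_of_isStrictlyLE b' _ (by omega)⟩

instance : (boundedComplexes A).IsTriangulated := by
  have h₀ : (boundedComplexes A).ContainsZero :=
    ⟨⟨(HomotopyCategory.quotient _ _).obj 0, Functor.map_isZero _ (isZero_zero _), 0, 0,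
      (inferInstance : CochainComplex.IsStrictlyGE (0 : CochainComplex A ℤ) 0),
      (inferInstance : CochainComplex.IsStrictlyLE (0 : CochainComplex A ℤ) 0)⟩⟩
  have h₁ : (boundedComplexes A).IsStableUnderShift ℤ :=
    { isStableUnderShiftBy := fun n =>
        { le_shift := by
            intro K hK
            obtain ⟨K : CochainComplex _ _, rfl⟩ := K.quotient_obj_surjective
            obtain ⟨a, b, ha, hb⟩ := hK
            change CochainComplex.IsStrictlyGE K a at ha
            change CochainComplex.IsStrictlyLE K b at hb
            rw [ObjectProperty.prop_shift_iff, HomotopyCategory.shift_quotient_obj]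
            exact ⟨a - n, b - n, CochainComplex.isStrictlyGE_shift K a n (a - n) (by omega),
              CochainComplex.isStrictlyLE_shift K b n (b - n) (by omega)⟩ } }
  have h₃ : (boundedComplexes A).IsTriangulatedClosed₃ :=
    { ext₃' := fun T hT hT₁ hT₂ => by
        obtain ⟨f, hf⟩ := (HomotopyCategory.quotient A (ComplexShape.up ℤ)).map_surjective
          (X := T.obj₁.as) (Y := T.obj₂.as) T.mor₁
        exact ⟨_, boundedComplexes_mappingCone f hT₁ hT₂,
          ⟨Triangle.π₃.mapIso (isoTriangleOfIso₁₂ T _ hT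
            (HomotopyCategory.mappingCone_triangleh_distinguished f)
            (Iso.refl _) (Iso.refl _) ((Category.comp_id _).trans
              (hf.symm.trans (Category.id_comp _).symm)))⟩⟩ }
  have h₂ := ObjectProperty.IsTriangulatedClosed₂.of_isTriangulatedClosed₃
    (P := boundedComplexes A)
  exact { }

/-- The bounded homotopy category `K^b(A)`. -/
abbrev Kb := (boundedComplexes A).FullSubcategory

/-- The bounded acyclic complexes `K^b_ac(A)` in `K^b(A)`. -/
abbrev acyclicKb : ObjectProperty (Kb A) :=
  (HomotopyCategory.subcategoryAcyclic A).inverseImage (boundedComplexes A).ι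

instance : IsTriangulated (Kb A) := inferInstance

instance : (acyclicKb A).IsTriangulated := inferInstance

end Bounded

section Verdier

variable {T : Type u₁} [Category.{v₁} T] [HasZeroObject T] [HasShift T ℤ] [Preadditive T]
  [∀ n : ℤ, (shiftFunctor T n).Additive] [Pretriangulated T] [IsTriangulated T]

/-- The Verdier quotient `T/N` of a triangulated category by a triangulated subcategory:
the localization at the morphisms whose cone is in `N`. -/
abbrev VerdierQuotient (N : ObjectProperty T) [N.IsTriangulated] := N.trW.Localization

/-- The quotient functor `T ⥤ T/N`. -/
abbrev quotientFunctor (N : ObjectProperty T) [N.IsTriangulated] : T ⥤ VerdierQuotient N :=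
  N.trW.Q

instance (N : ObjectProperty T) [N.IsTriangulated] : Preadditive (VerdierQuotient N) :=
  inferInstance

instance (N : ObjectProperty T) [N.IsTriangulated] : HasZeroObject (VerdierQuotient N) :=
  inferInstance

instance (N : ObjectProperty T) [N.IsTriangulated] : HasShift (VerdierQuotient N) ℤ :=
  inferInstance

instance (N : ObjectProperty T) [N.IsTriangulated] (n : ℤ) :
    (shiftFunctor (VerdierQuotient N) n).Additive :=
  inferInstance

instance (N : ObjectProperty T) [N.IsTriangulated] : Pretriangulated (VerdierQuotient N) :=
  inferInstance

instance (N : ObjectProperty T) [N.IsTriangulated] : IsTriangulated (VerdierQuotient N) :=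
  inferInstance

instance (N : ObjectProperty T) [N.IsTriangulated] : (quotientFunctor N).IsTriangulated :=
  inferInstance

end Verdier

variable (A : Type u₁) [Category.{v₁} A] [Abelian A]
variable (B : Type u₂) [Category.{v₂} B] [Abelian B]

/-- The bounded derived category `D^b(A) = K^b(A)/K^b_ac(A)`. -/
abbrev Db := VerdierQuotient (acyclicKb A)

section Exact

variable {A B} (Θ : A ⥤ B) [Θ.Additive]

/-- An additive functor applied term by term to bounded complexes up to homotopy. -/
def mapKb : Kb A ⥤ Kb B :=
  (boundedComplexes B).lift
    ((boundedComplexes A).ι ⋙ Θ.mapHomotopyCategory (ComplexShape.up ℤ)) (by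
      rintro ⟨⟨K⟩, a, b, ha, hb⟩
      change CochainComplex.IsStrictlyGE K a at ha
      change CochainComplex.IsStrictlyLE K b at hb
      exact ⟨a, b,
        inferInstanceAs (CochainComplex.IsStrictlyGE ((Θ.mapHomologicalComplex _).obj K) a),
        inferInstanceAs (CochainComplex.IsStrictlyLE ((Θ.mapHomologicalComplex _).obj K) b)⟩)

instance : (mapKb Θ).CommShift ℤ :=
  inferInstanceAs (((boundedComplexes B).lift
    ((boundedComplexes A).ι ⋙ Θ.mapHomotopyCategory (ComplexShape.up ℤ)) _).CommShift ℤ)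

instance : (mapKb Θ).IsTriangulated :=
  inferInstanceAs (((boundedComplexes B).lift
    ((boundedComplexes A).ι ⋙ Θ.mapHomotopyCategory (ComplexShape.up ℤ)) _).IsTriangulated)

variable [Θ.PreservesHomology]

theorem acyclicKb_mapKb (K : Kb A) (hK : acyclicKb A K) : acyclicKb B ((mapKb Θ).obj K) := by
  obtain ⟨⟨K⟩, hb⟩ := K
  have hK' : K.Acyclic :=
    (HomotopyCategory.quotient_obj_mem_subcategoryAcyclic_iff_acyclic K).1 hK
  refine (HomotopyCategory.quotient_obj_mem_subcategoryAcyclic_iff_acyclic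
    ((Θ.mapHomologicalComplex _).obj K)).2 fun n => ?_
  exact (hK' n).map Θ

theorem trW_mapKb {K L : Kb A} (f : K ⟶ L) (hf : (acyclicKb A).trW f) :
    (acyclicKb B).trW ((mapKb Θ).map f) := by
  obtain ⟨Z, g, h, hT, hZ⟩ := hf
  exact ⟨_, _, _, (mapKb Θ).map_distinguished _ hT, acyclicKb_mapKb Θ Z hZ⟩

/-- The functor `D^b(A) ⥤ D^b(B)` that applies an exact functor `Θ : A ⥤ B` term by term. -/
def mapDb : Db A ⥤ Db B :=
  Localization.lift (mapKb Θ ⋙ quotientFunctor (acyclicKb B))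
    (fun _ _ f hf => Localization.inverts (quotientFunctor (acyclicKb B)) _ _ (trW_mapKb Θ f hf))
    (quotientFunctor (acyclicKb A))

instance : Localization.Lifting (quotientFunctor (acyclicKb A)) (acyclicKb A).trW
    (mapKb Θ ⋙ quotientFunctor (acyclicKb B)) (mapDb Θ) :=
  Localization.liftingLift _ _ _

/-- `mapDb Θ` is computed term by term. -/
def mapDbFactors : quotientFunctor (acyclicKb A) ⋙ mapDb Θ ≅
    mapKb Θ ⋙ quotientFunctor (acyclicKb B) :=
  Localization.Lifting.iso (quotientFunctor (acyclicKb A)) (acyclicKb A).trW _ _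

instance : (mapDb Θ).CommShift ℤ :=
  Functor.commShiftOfLocalization (quotientFunctor (acyclicKb A)) (acyclicKb A).trW ℤ
    (mapKb Θ ⋙ quotientFunctor (acyclicKb B)) (mapDb Θ)

instance : NatTrans.CommShift (mapDbFactors Θ).hom ℤ :=
  inferInstanceAs (NatTrans.CommShift (Localization.Lifting.iso
    (quotientFunctor (acyclicKb A)) (acyclicKb A).trW
      (mapKb Θ ⋙ quotientFunctor (acyclicKb B)) (mapDb Θ)).hom ℤ)

instance : (quotientFunctor (acyclicKb A)).mapArrow.EssSurj :=
  Localization.essSurj_mapArrow _ (acyclicKb A).trW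

instance : (mapDb Θ).IsTriangulated :=
  Functor.isTriangulated_of_precomp_iso (mapDbFactors Θ)

end Exact

section Kernel

variable {T : Type u₁} [Category.{v₁} T] [HasZeroObject T] [HasShift T ℤ] [Preadditive T]
  [∀ n : ℤ, (shiftFunctor T n).Additive] [Pretriangulated T]
  {T' : Type u₂} [Category.{v₂} T'] [HasZeroObject T'] [HasShift T' ℤ] [Preadditive T']
  [∀ n : ℤ, (shiftFunctor T' n).Additive] [Pretriangulated T']

/-- The kernel of a triangle functor: the objects `X` with `Φ(X) ≃ 0`. -/
def kernelOf (Φ : T ⥤ T') : ObjectProperty T := fun X => IsZero (Φ.obj X)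

instance kernelOf_isTriangulated (Φ : T ⥤ T') [Φ.CommShift ℤ] [Φ.IsTriangulated] :
    (kernelOf Φ).IsTriangulated where
  exists_zero := ⟨0, isZero_zero _, Functor.map_isZero Φ (isZero_zero _)⟩
  isStableUnderShiftBy n :=
    { le_shift := fun X hX =>
        ((shiftFunctor T' n).map_isZero hX).of_iso ((Φ.commShiftIso n).app X) }
  ext₂' _ hT h₁ h₃ :=
    ObjectProperty.le_isoClosure _ _
      ((Triangle.isZero₂_iff _ (Φ.map_distinguished _ hT)).2
        ⟨h₁.eq_of_src _ _, h₃.eq_of_tgt _ _⟩)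

end Kernel

variable {A B} in
instance (Θ : A ⥤ B) [Θ.Additive] [Θ.PreservesHomology] :
    (kernelOf (mapDb Θ)).IsTriangulated :=
  kernelOf_isTriangulated _

section Functors

open Opposite

universe v u

variable {𝒜 : Type u} [Category.{v} 𝒜]

/-- `𝒳` is contravariantly finite: every object `M` has a right `𝒳`-approximation, that is, a
morphism `X ⟶ M` with `X` in `𝒳` through which every morphism from an object of `𝒳` factors. -/
class IsContravariantlyFinite (𝒳 : ObjectProperty 𝒜) : Prop where
  exists_approx (M : 𝒜) : ∃ (X : 𝒜) (_ : 𝒳 X) (φ : X ⟶ M),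
    ∀ (Y : 𝒜) (_ : 𝒳 Y) (g : Y ⟶ M), ∃ h : Y ⟶ X, h ≫ φ = g

variable [Abelian 𝒜] (𝒳 : ObjectProperty 𝒜)

variable {𝒳} in
/-- A presentation `𝒳(-, X₁) ⟶ 𝒳(-, X₀) ⟶ F ⟶ 0` of a contravariant functor on `𝒳`
by representable functors, exact at every object of `𝒳`. -/
structure Presentation (F : 𝒳.FullSubcategoryᵒᵖ ⥤ AddCommGrpCat.{v}) where
  X₁ : 𝒳.FullSubcategory
  X₀ : 𝒳.FullSubcategory
  d : X₁ ⟶ X₀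
  π : preadditiveYoneda.obj X₀ ⟶ F
  exact (Y : 𝒳.FullSubcategoryᵒᵖ) :
    Function.Exact ((preadditiveYoneda.map d).app Y) (π.app Y)
  surjective (Y : 𝒳.FullSubcategoryᵒᵖ) : Function.Surjective (π.app Y)

/-- The finitely presented `𝒳`-modules among the contravariant functors from `𝒳` to
abelian groups: they are additive and have a presentation by representable functors. -/
def isFinitelyPresented : ObjectProperty (𝒳.FullSubcategoryᵒᵖ ⥤ AddCommGrpCat.{v}) :=
  fun F => F.Additive ∧ Nonempty (Presentation F)

/-- The category `mod-𝒳` of finitely presented `𝒳`-modules. -/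
abbrev ModCat := (isFinitelyPresented 𝒳).FullSubcategory

variable {𝒳}

theorem map_add_op_apply (F : 𝒳.FullSubcategoryᵒᵖ ⥤ AddCommGrpCat.{v}) [F.Additive]
    {Y Z : 𝒳.FullSubcategory} (g h : Z ⟶ Y) (z : F.obj (op Y)) :
    F.map (g + h).op z = F.map g.op z + F.map h.op z := by
  rw [op_add, F.map_add]
  rfl

theorem map_zero_op_apply (F : 𝒳.FullSubcategoryᵒᵖ ⥤ AddCommGrpCat.{v}) [F.Additive]
    {Y Z : 𝒳.FullSubcategory} (z : F.obj (op Y)) : F.map (0 : Z ⟶ Y).op z = 0 := by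
  rw [op_zero, F.map_zero]
  rfl

theorem map_comp_op_apply (F : 𝒳.FullSubcategoryᵒᵖ ⥤ AddCommGrpCat.{v})
    {X Y Z : 𝒳.FullSubcategory} (h : Z ⟶ Y) (k : Y ⟶ X) (z : F.obj (op X)) :
    F.map (h ≫ k).op z = F.map h.op (F.map k.op z) := by
  rw [op_comp, F.map_comp]
  rfl

namespace Presentation

variable {F : 𝒳.FullSubcategoryᵒᵖ ⥤ AddCommGrpCat.{v}} (p : Presentation F)

/-- The generator of `F`, that is, the image of the identity of `X₀`. -/
def gen : F.obj (op p.X₀) := p.π.app (op p.X₀) (𝟙 p.X₀ : p.X₀ ⟶ p.X₀)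

theorem π_apply {Y : 𝒳.FullSubcategory} (g : Y ⟶ p.X₀) :
    p.π.app (op Y) (show (preadditiveYoneda.obj p.X₀).obj (op Y) from g) =
      F.map g.op p.gen := by
  have := ConcreteCategory.congr_hom (p.π.naturality g.op) (𝟙 p.X₀ : p.X₀ ⟶ p.X₀)
  refine Eq.trans ?_ this
  change _ = p.π.app (op Y) (show (preadditiveYoneda.obj p.X₀).obj (op Y) from g ≫ 𝟙 p.X₀)
  rw [Category.comp_id]

theorem exists_eq {Y : 𝒳.FullSubcategory} (y : F.obj (op Y)) :
    ∃ g : Y ⟶ p.X₀, F.map g.op p.gen = y := by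
  obtain ⟨g, hg⟩ := p.surjective (op Y) y
  exact ⟨g, (p.π_apply g).symm.trans hg⟩

theorem map_gen_eq_zero_iff {Y : 𝒳.FullSubcategory} (g : Y ⟶ p.X₀) :
    F.map g.op p.gen = 0 ↔ ∃ h : Y ⟶ p.X₁, h ≫ p.d = g := by
  rw [← p.π_apply]
  exact p.exact (op Y) g

/-- A presentation from a generator and its relations. -/
def ofGen [F.Additive] {X₁ X₀ : 𝒳.FullSubcategory} (d : X₁ ⟶ X₀) (x : F.obj (op X₀))
    (hx : ∀ (Y : 𝒳.FullSubcategory) (y : F.obj (op Y)), ∃ g : Y ⟶ X₀, F.map g.op x = y)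
    (hd : ∀ (Y : 𝒳.FullSubcategory) (g : Y ⟶ X₀),
      F.map g.op x = 0 ↔ ∃ h : Y ⟶ X₁, h ≫ d = g) : Presentation F where
  X₁ := X₁
  X₀ := X₀
  d := d
  π :=
    { app := fun Y => AddCommGrpCat.ofHom
        (AddMonoidHom.mk' (fun g : Y.unop ⟶ X₀ => F.map g.op x) (fun g h =>
          map_add_op_apply F g h x))
      naturality := fun _ _ f => AddCommGrpCat.ext fun g =>
        map_comp_op_apply F f.unop g x }
  exact Y g := hd Y.unop g
  surjective Y y := hx Y.unop y

end Presentation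

/-- A functor that is presented, on `𝒳`, by arbitrary objects of `𝒜` is finitely presented. -/
theorem isFinitelyPresented_of_weak [IsContravariantlyFinite 𝒳]
    {F : 𝒳.FullSubcategoryᵒᵖ ⥤ AddCommGrpCat.{v}} {N M : 𝒜} (δ : N ⟶ M)
    (p : ∀ Y : 𝒳.FullSubcategory, (Y.obj ⟶ M) → F.obj (op Y))
    (p_add : ∀ Y (a b : Y.obj ⟶ M), p Y (a + b) = p Y a + p Y b)
    (p_map : ∀ Y Z (h : Z ⟶ Y) (a : Y.obj ⟶ M), F.map h.op (p Y a) = p Z (h.hom ≫ a))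
    (p_surj : ∀ Y, Function.Surjective (p Y))
    (p_ker : ∀ Y (a : Y.obj ⟶ M), p Y a = 0 ↔ ∃ b : Y.obj ⟶ N, b ≫ δ = a) :
    isFinitelyPresented 𝒳 F := by
  have hF : F.Additive := ⟨fun {Y Z f g} => AddCommGrpCat.ext fun y => by
    obtain ⟨a, rfl⟩ := p_surj _ y
    change F.map (f.unop + g.unop).op (p Y.unop a) =
      F.map f.unop.op (p Y.unop a) + F.map g.unop.op (p Y.unop a)
    rw [p_map, p_map, p_map, ← p_add, ← Preadditive.add_comp]
    rfl⟩
  obtain ⟨X₀, h₀, φ, hφ⟩ := IsContravariantlyFinite.exists_approx (𝒳 := 𝒳) M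
  obtain ⟨X₁, h₁, ψ, hψ⟩ := IsContravariantlyFinite.exists_approx (𝒳 := 𝒳) (pullback φ δ)
  refine ⟨hF, ⟨Presentation.ofGen (X₁ := ⟨X₁, h₁⟩) (X₀ := ⟨X₀, h₀⟩)
    (ObjectProperty.homMk (ψ ≫ pullback.fst φ δ)) (p ⟨X₀, h₀⟩ φ) ?_ ?_⟩⟩
  · intro Y y
    obtain ⟨a, rfl⟩ := p_surj _ y
    obtain ⟨h, hh⟩ := hφ _ Y.property a
    refine ⟨ObjectProperty.homMk h, ?_⟩
    rw [p_map]
    exact congrArg _ hh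
  · intro Y g
    rw [p_map, p_ker]
    constructor
    · rintro ⟨b, hb⟩
      obtain ⟨h, hh⟩ := hψ _ Y.property (pullback.lift g.hom b hb.symm)
      refine ⟨ObjectProperty.homMk h, ?_⟩
      ext
      change h ≫ ψ ≫ pullback.fst φ δ = g.hom
      rw [← Category.assoc, hh, pullback.lift_fst]
    · rintro ⟨h, rfl⟩
      refine ⟨h.hom ≫ ψ ≫ pullback.snd φ δ, ?_⟩
      change _ = (h.hom ≫ ψ ≫ pullback.fst φ δ) ≫ φ
      simp only [Category.assoc, pullback.condition]

theorem isFinitelyPresented.elim {F : 𝒳.FullSubcategoryᵒᵖ ⥤ AddCommGrpCat.{v}}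
    (hF : isFinitelyPresented 𝒳 F) : ∃ (X₁ X₀ : 𝒳.FullSubcategory) (d : X₁ ⟶ X₀)
      (x : F.obj (op X₀)),
      (∀ (Y : 𝒳.FullSubcategory) (y : F.obj (op Y)), ∃ g : Y ⟶ X₀, F.map g.op x = y) ∧
      ∀ (Y : 𝒳.FullSubcategory) (g : Y ⟶ X₀),
        F.map g.op x = 0 ↔ ∃ h : Y ⟶ X₁, h ≫ d = g := by
  obtain ⟨-, ⟨p⟩⟩ := hF
  exact ⟨p.X₁, p.X₀, p.d, p.gen, fun Y y => p.exists_eq y, fun Y g => p.map_gen_eq_zero_iff g⟩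

instance : (isFinitelyPresented 𝒳).IsClosedUnderIsomorphisms where
  of_iso {F G} e := by
    rintro ⟨hF, ⟨p⟩⟩
    refine ⟨Functor.additive_of_iso e, ⟨⟨p.X₁, p.X₀, p.d, p.π ≫ e.hom, ?_, ?_⟩⟩⟩
    · intro Y g
      refine Iff.trans ⟨fun h => ?_, fun h => ?_⟩ (p.exact Y g)
      · have h' : e.inv.app Y (e.hom.app Y (p.π.app Y g)) = 0 :=
          (congrArg (e.inv.app Y) h).trans (map_zero (e.inv.app Y).hom)
        rwa [← ConcreteCategory.comp_apply, Iso.hom_inv_id_app] at h'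
      · change e.hom.app Y (p.π.app Y g) = 0
        rw [h]
        exact map_zero (e.hom.app Y).hom
    · intro Y y
      obtain ⟨g, hg⟩ := p.surjective Y (e.inv.app Y y)
      refine ⟨g, ?_⟩
      change e.hom.app Y (p.π.app Y g) = y
      rw [hg, ← ConcreteCategory.comp_apply, Iso.inv_hom_id_app]
      rfl

section Abelian

variable [IsContravariantlyFinite 𝒳]

instance : (isFinitelyPresented 𝒳).ContainsZero where
  exists_zero := by
    refine ⟨0, isZero_zero _, ?_⟩
    have h0 : ∀ Y, Subsingleton ((0 : 𝒳.FullSubcategoryᵒᵖ ⥤ AddCommGrpCat.{v}).obj Y) := fun Y =>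
      AddCommGrpCat.subsingleton_of_isZero
        (((evaluation _ _).obj Y).map_isZero (isZero_zero (𝒳.FullSubcategoryᵒᵖ ⥤ AddCommGrpCat.{v})))
    exact isFinitelyPresented_of_weak (N := (0 : 𝒜)) (M := 0) (𝟙 0) (fun _ _ => 0)
      (fun _ _ _ => Subsingleton.elim _ _) (fun _ _ _ _ => Subsingleton.elim _ _)
      (fun Y y => ⟨0, Subsingleton.elim _ _⟩) (fun Y a => ⟨fun _ => ⟨a, Category.comp_id _⟩,
        fun _ => rfl⟩)

theorem isFinitelyPresented_cokernel {G F : 𝒳.FullSubcategoryᵒᵖ ⥤ AddCommGrpCat.{v}} (f : G ⟶ F)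
    (hG : isFinitelyPresented 𝒳 G) (hF : isFinitelyPresented 𝒳 F)
    {C : 𝒳.FullSubcategoryᵒᵖ ⥤ AddCommGrpCat.{v}} (π : F ⟶ C)
    (hπ : ∀ Y, Function.Surjective (π.app Y))
    (hf : ∀ Y, Function.Exact (f.app Y) (π.app Y)) : isFinitelyPresented 𝒳 C := by
  have := hF.1
  have := hG.1
  obtain ⟨X₁, X₀, d, x, hx, hd⟩ := hF.elim
  obtain ⟨-, Y₀, -, y, hy, -⟩ := hG.elim
  obtain ⟨g, hg⟩ := hx _ (f.app _ y)
  have nat {Y Z} (h : Z ⟶ Y) (z : F.obj (op Y)) :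
      C.map h.op (π.app _ z) = π.app _ (F.map h.op z) :=
    (ConcreteCategory.congr_hom (π.naturality h.op) z).symm
  have natf {Y Z} (h : Z ⟶ Y) (z : G.obj (op Y)) :
      F.map h.op (f.app _ z) = f.app _ (G.map h.op z) :=
    (ConcreteCategory.congr_hom (f.naturality h.op) z).symm
  refine isFinitelyPresented_of_weak (N := X₁.obj ⊞ Y₀.obj) (M := X₀.obj)
    (biprod.desc d.hom g.hom)
    (fun Y a => π.app _ (F.map (ObjectProperty.homMk a : Y ⟶ X₀).op x)) ?_ ?_ ?_ ?_
  · intro Y a b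
    refine (congrArg _ (map_add_op_apply F (ObjectProperty.homMk a : Y ⟶ X₀) (ObjectProperty.homMk b) x)).trans ?_
    exact map_add (π.app (op Y)).hom _ _
  · intro Y Z h a
    rw [nat, ← map_comp_op_apply]
    rfl
  · intro Y c
    obtain ⟨z, rfl⟩ := hπ _ c
    obtain ⟨a, rfl⟩ := hx _ z
    exact ⟨a.hom, rfl⟩
  · intro Y a
    constructor
    · intro h
      obtain ⟨z, hz⟩ := (hf _ _).1 h
      obtain ⟨b, rfl⟩ := hy _ z
      rw [← natf, ← hg, ← map_comp_op_apply] at hz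
      obtain ⟨c, hc⟩ := (hd Y ((ObjectProperty.homMk a : Y ⟶ X₀) + -(b ≫ g))).1 (by
        rw [map_add_op_apply, ← hz, ← map_add_op_apply, add_neg_cancel]
        exact map_zero_op_apply F x)
      refine ⟨biprod.lift c.hom b.hom, ?_⟩
      rw [biprod.lift_desc]
      have hc' : c.hom ≫ d.hom = a + -(b.hom ≫ g.hom) := congrArg (fun t => t.hom) hc
      rw [hc']
      abel
    · rintro ⟨b, rfl⟩
      refine (hf _ _).2 ⟨G.map (ObjectProperty.homMk (b ≫ biprod.snd) : Y ⟶ Y₀).op y, ?_⟩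
      rw [← natf, ← hg, ← map_comp_op_apply]
      have : (ObjectProperty.homMk (b ≫ biprod.desc d.hom g.hom) : Y ⟶ X₀) =
          (ObjectProperty.homMk (b ≫ biprod.fst) : Y ⟶ X₁) ≫ d +
            (ObjectProperty.homMk (b ≫ biprod.snd) : Y ⟶ Y₀) ≫ g := by
        ext
        change b ≫ biprod.desc d.hom g.hom =
          (b ≫ biprod.fst) ≫ d.hom + (b ≫ biprod.snd) ≫ g.hom
        rw [biprod.desc_eq]
        simp
      rw [this, map_add_op_apply, (hd Y _).2 ⟨_, rfl⟩, zero_add]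

theorem isFinitelyPresented_kernel {F F' : 𝒳.FullSubcategoryᵒᵖ ⥤ AddCommGrpCat.{v}} (f : F ⟶ F')
    (hF : isFinitelyPresented 𝒳 F) (hF' : isFinitelyPresented 𝒳 F')
    {K : 𝒳.FullSubcategoryᵒᵖ ⥤ AddCommGrpCat.{v}} (ι : K ⟶ F)
    (hι : ∀ Y, Function.Injective (ι.app Y))
    (hf : ∀ Y, Function.Exact (ι.app Y) (f.app Y)) : isFinitelyPresented 𝒳 K := by
  have := hF.1
  have := hF'.1
  obtain ⟨X₁, X₀, d, x, hx, hd⟩ := hF.elim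
  obtain ⟨X₁', X₀', d', x', hx', hd'⟩ := hF'.elim
  obtain ⟨g, hg⟩ := hx' _ (f.app _ x)
  have natι {Y Z} (h : Z ⟶ Y) (z : K.obj (op Y)) :
      F.map h.op (ι.app _ z) = ι.app _ (K.map h.op z) :=
    (ConcreteCategory.congr_hom (ι.naturality h.op) z).symm
  have natf {Y Z} (h : Z ⟶ Y) (z : F.obj (op Y)) :
      F'.map h.op (f.app _ z) = f.app _ (F.map h.op z) :=
    (ConcreteCategory.congr_hom (f.naturality h.op) z).symm
  -- an element of `F` is killed by `f` iff it comes from the pullback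
  have key {Y : 𝒳.FullSubcategory} (a : Y ⟶ X₀) :
      f.app _ (F.map a.op x) = 0 ↔ ∃ b : Y ⟶ X₁', b ≫ d' = a ≫ g := by
    rw [← natf, ← hg, ← map_comp_op_apply, hd']
  have ex : ∀ (Y : 𝒳.FullSubcategory) (a : Y.obj ⟶ pullback g.hom d'.hom),
      ∃ k : K.obj (op Y), ι.app _ k =
        F.map (ObjectProperty.homMk (a ≫ pullback.fst g.hom d'.hom) : Y ⟶ X₀).op x := by
    intro Y a
    refine (hf _ _).1 ((key _).2 ⟨ObjectProperty.homMk (a ≫ pullback.snd g.hom d'.hom), ?_⟩)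
    ext
    change (a ≫ pullback.snd g.hom d'.hom) ≫ d'.hom = (a ≫ pullback.fst g.hom d'.hom) ≫ g.hom
    simp only [Category.assoc, pullback.condition]
  choose p hp using ex
  refine isFinitelyPresented_of_weak (N := pullback (pullback.fst g.hom d'.hom) d.hom)
    (M := pullback g.hom d'.hom) (pullback.fst _ _) p ?_ ?_ ?_ ?_
  · intro Y a b
    apply hι
    refine Eq.trans ?_ (map_add (ι.app (op Y)).hom _ _).symm
    refine Eq.trans ?_ (congrArg₂ (· + ·) (hp Y a) (hp Y b)).symm
    rw [hp, ← map_add_op_apply]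
    exact congrArg (fun t : Y ⟶ X₀ => F.map t.op x)
      (ObjectProperty.hom_ext _ (Preadditive.add_comp _ _ _ a b (pullback.fst g.hom d'.hom)))
  · intro Y Z h a
    apply hι
    rw [← natι, hp, hp, ← map_comp_op_apply]
    exact congrArg (fun t : Z ⟶ X₀ => F.map t.op x)
      (ObjectProperty.hom_ext _ (Category.assoc h.hom a (pullback.fst g.hom d'.hom)).symm)
  · intro Y k
    obtain ⟨a, ha⟩ := hx _ (ι.app _ k)
    obtain ⟨b, hb⟩ := (key a).1 (by rw [ha]; exact (hf _ _).2 ⟨k, rfl⟩)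
    refine ⟨pullback.lift a.hom b.hom (congrArg (fun t => t.hom) hb).symm, ?_⟩
    apply hι
    rw [hp, ← ha, pullback.lift_fst]
    rfl
  · intro Y a
    have : p Y a = 0 ↔ ι.app _ (p Y a) = 0 :=
      ⟨fun h => by rw [h]; exact map_zero (ι.app (op Y)).hom,
        fun h => hι _ (h.trans (map_zero (ι.app (op Y)).hom).symm)⟩
    rw [this, hp, hd]
    constructor
    · rintro ⟨h, hh⟩
      exact ⟨pullback.lift a h.hom (congrArg (fun t => t.hom) hh).symm, pullback.lift_fst _ _ _⟩
    · rintro ⟨b, rfl⟩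
      refine ⟨ObjectProperty.homMk (b ≫ pullback.snd _ _), ?_⟩
      ext
      change (b ≫ pullback.snd _ _) ≫ d.hom = (b ≫ pullback.fst _ _) ≫ pullback.fst _ _
      simp only [Category.assoc, pullback.condition]

instance : (isFinitelyPresented 𝒳).IsClosedUnderCokernels where
  cokernels_le := by
    rintro C ⟨f, c, hc, hf⟩
    have : Epi c.π := ⟨fun _ _ h => Cofork.IsColimit.hom_ext hc h⟩
    refine isFinitelyPresented_cokernel f hf.1 hf.2 c.π (fun Y => ?_) (fun Y => ?_)
    · exact (AddCommGrpCat.epi_iff_surjective _).1 ((NatTrans.epi_iff_epi_app _).1 this Y)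
    · have h := (ShortComplex.exact_of_g_is_cokernel (.mk f c.π c.condition)
        (hc.ofIsoColimit (Cofork.ext (Iso.refl _)))).map ((evaluation _ _).obj Y)
      exact (ShortComplex.ab_exact_iff_function_exact _).1 h

instance : (isFinitelyPresented 𝒳).IsClosedUnderKernels where
  kernels_le := by
    rintro K ⟨f, k, hk, hf⟩
    have : Mono k.ι := ⟨fun _ _ h => Fork.IsLimit.hom_ext hk h⟩
    refine isFinitelyPresented_kernel f hf.1 hf.2 k.ι (fun Y => ?_) (fun Y => ?_)
    · exact (AddCommGrpCat.mono_iff_injective _).1 ((NatTrans.mono_iff_mono_app _).1 this Y)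
    · have h := (ShortComplex.exact_of_f_is_kernel (.mk k.ι f k.condition)
        (hk.ofIsoLimit (Fork.ext (Iso.refl _)))).map ((evaluation _ _).obj Y)
      exact (ShortComplex.ab_exact_iff_function_exact _).1 h

theorem isFinitelyPresented_biprod {F F' : 𝒳.FullSubcategoryᵒᵖ ⥤ AddCommGrpCat.{v}}
    (hF : isFinitelyPresented 𝒳 F) (hF' : isFinitelyPresented 𝒳 F') :
    isFinitelyPresented 𝒳 (F ⊞ F') := by
  have := hF.1
  have := hF'.1
  obtain ⟨X₁, X₀, d, x, hx, hd⟩ := hF.elim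
  obtain ⟨X₁', X₀', d', x', hx', hd'⟩ := hF'.elim
  let e (Y : 𝒳.FullSubcategory) (a : Y ⟶ X₀) (a' : Y ⟶ X₀') : (F ⊞ F').obj (op Y) :=
    (biprod.inl : F ⟶ F ⊞ F').app _ (F.map a.op x) +
      (biprod.inr : F' ⟶ F ⊞ F').app _ (F'.map a'.op x')
  have e_fst (Y) (a : Y ⟶ X₀) (a' : Y ⟶ X₀') :
      (biprod.fst : F ⊞ F' ⟶ F).app _ (e Y a a') = F.map a.op x := by
    refine (map_add ((biprod.fst : F ⊞ F' ⟶ F).app (op Y)).hom _ _).trans ?_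
    have h₁ := ConcreteCategory.congr_hom
      (congrArg (fun t => t.app (op Y)) (biprod.inl_fst (X := F) (Y := F'))) (F.map a.op x)
    have h₂ := ConcreteCategory.congr_hom
      (congrArg (fun t => t.app (op Y)) (biprod.inr_fst (X := F) (Y := F'))) (F'.map a'.op x')
    exact (congrArg₂ (· + ·) h₁ h₂).trans (add_zero _)
  have e_snd (Y) (a : Y ⟶ X₀) (a' : Y ⟶ X₀') :
      (biprod.snd : F ⊞ F' ⟶ F').app _ (e Y a a') = F'.map a'.op x' := by
    refine (map_add ((biprod.snd : F ⊞ F' ⟶ F').app (op Y)).hom _ _).trans ?_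
    have h₁ := ConcreteCategory.congr_hom
      (congrArg (fun t => t.app (op Y)) (biprod.inl_snd (X := F) (Y := F'))) (F.map a.op x)
    have h₂ := ConcreteCategory.congr_hom
      (congrArg (fun t => t.app (op Y)) (biprod.inr_snd (X := F) (Y := F'))) (F'.map a'.op x')
    exact (congrArg₂ (· + ·) h₁ h₂).trans (zero_add _)
  have total (Y : 𝒳.FullSubcategory) (z : (F ⊞ F').obj (op Y)) :
      (biprod.inl : F ⟶ F ⊞ F').app _ ((biprod.fst : F ⊞ F' ⟶ F).app _ z) +
        (biprod.inr : F' ⟶ F ⊞ F').app _ ((biprod.snd : F ⊞ F' ⟶ F').app _ z) = z :=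
    ConcreteCategory.congr_hom
      (congrArg (fun t => t.app (op Y)) (biprod.total (X := F) (Y := F'))) z
  have natl {Y Z} (h : Z ⟶ Y) (z : F.obj (op Y)) :
      (F ⊞ F').map h.op ((biprod.inl : F ⟶ F ⊞ F').app _ z) =
        (biprod.inl : F ⟶ F ⊞ F').app _ (F.map h.op z) :=
    (ConcreteCategory.congr_hom ((biprod.inl : F ⟶ F ⊞ F').naturality h.op) z).symm
  have natr {Y Z} (h : Z ⟶ Y) (z : F'.obj (op Y)) :
      (F ⊞ F').map h.op ((biprod.inr : F' ⟶ F ⊞ F').app _ z) =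
        (biprod.inr : F' ⟶ F ⊞ F').app _ (F'.map h.op z) :=
    (ConcreteCategory.congr_hom ((biprod.inr : F' ⟶ F ⊞ F').naturality h.op) z).symm
  have e_zero (Y) (a : Y ⟶ X₀) (a' : Y ⟶ X₀') :
      e Y a a' = 0 ↔ F.map a.op x = 0 ∧ F'.map a'.op x' = 0 := by
    constructor
    · intro h
      rw [← e_fst Y a a', ← e_snd Y a a', h]
      exact ⟨map_zero ((biprod.fst : F ⊞ F' ⟶ F).app (op Y)).hom,
        map_zero ((biprod.snd : F ⊞ F' ⟶ F').app (op Y)).hom⟩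
    · rintro ⟨h, h'⟩
      refine (congrArg₂ (· + ·) (congrArg _ h) (congrArg _ h')).trans ?_
      refine (congrArg₂ (· + ·) (map_zero ((biprod.inl : F ⟶ F ⊞ F').app (op Y)).hom)
        (map_zero ((biprod.inr : F' ⟶ F ⊞ F').app (op Y)).hom)).trans (add_zero _)
  refine isFinitelyPresented_of_weak (N := X₁.obj ⊞ X₁'.obj) (M := X₀.obj ⊞ X₀'.obj)
    (biprod.map d.hom d'.hom)
    (fun Y a => e Y (ObjectProperty.homMk (a ≫ biprod.fst))
      (ObjectProperty.homMk (a ≫ biprod.snd))) ?_ ?_ ?_ ?_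
  · intro Y a b
    have h₁ : (ObjectProperty.homMk ((a + b) ≫ biprod.fst) : Y ⟶ X₀) =
        ObjectProperty.homMk (a ≫ biprod.fst) + ObjectProperty.homMk (b ≫ biprod.fst) :=
      ObjectProperty.hom_ext _ (Preadditive.add_comp _ _ _ a b biprod.fst)
    have h₂ : (ObjectProperty.homMk ((a + b) ≫ biprod.snd) : Y ⟶ X₀') =
        ObjectProperty.homMk (a ≫ biprod.snd) + ObjectProperty.homMk (b ≫ biprod.snd) :=
      ObjectProperty.hom_ext _ (Preadditive.add_comp _ _ _ a b biprod.snd)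
    rw [h₁, h₂]
    refine (congrArg₂ (· + ·) ((congrArg _ (map_add_op_apply F _ _ x)).trans
      (map_add ((biprod.inl : F ⟶ F ⊞ F').app (op Y)).hom _ _))
      ((congrArg _ (map_add_op_apply F' _ _ x')).trans
        (map_add ((biprod.inr : F' ⟶ F ⊞ F').app (op Y)).hom _ _))).trans ?_
    exact add_add_add_comm _ _ _ _
  · intro Y Z h a
    refine (map_add ((F ⊞ F').map h.op).hom _ _).trans ?_
    refine (congrArg₂ (· + ·) (natl h _) (natr h _)).trans ?_
    rw [← map_comp_op_apply, ← map_comp_op_apply]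
    have h₁ : (ObjectProperty.homMk ((h.hom ≫ a) ≫ biprod.fst) : Z ⟶ X₀) =
        h ≫ ObjectProperty.homMk (a ≫ biprod.fst) :=
      ObjectProperty.hom_ext _ (Category.assoc h.hom a biprod.fst)
    have h₂ : (ObjectProperty.homMk ((h.hom ≫ a) ≫ biprod.snd) : Z ⟶ X₀') =
        h ≫ ObjectProperty.homMk (a ≫ biprod.snd) :=
      ObjectProperty.hom_ext _ (Category.assoc h.hom a biprod.snd)
    rw [h₁, h₂]
  · intro Y z
    obtain ⟨a, ha⟩ := hx _ ((biprod.fst : F ⊞ F' ⟶ F).app _ z)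
    obtain ⟨a', ha'⟩ := hx' _ ((biprod.snd : F ⊞ F' ⟶ F').app _ z)
    refine ⟨biprod.lift a.hom a'.hom, Eq.trans ?_ (total Y z)⟩
    have h₁ : (ObjectProperty.homMk (biprod.lift a.hom a'.hom ≫ biprod.fst) : Y ⟶ X₀) = a :=
      ObjectProperty.hom_ext _ (biprod.lift_fst _ _)
    have h₂ : (ObjectProperty.homMk (biprod.lift a.hom a'.hom ≫ biprod.snd) : Y ⟶ X₀') = a' :=
      ObjectProperty.hom_ext _ (biprod.lift_snd _ _)
    beta_reduce
    rw [h₁, h₂, ← ha, ← ha']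
  · intro Y a
    rw [e_zero, hd, hd']
    constructor
    · rintro ⟨⟨b, hb⟩, ⟨b', hb'⟩⟩
      refine ⟨biprod.lift b.hom b'.hom, ?_⟩
      have h₁ : b.hom ≫ d.hom = a ≫ biprod.fst := congrArg (fun t => t.hom) hb
      have h₂ : b'.hom ≫ d'.hom = a ≫ biprod.snd := congrArg (fun t => t.hom) hb'
      apply biprod.hom_ext
      · simp [h₁]
      · simp [h₂]
    · rintro ⟨b, rfl⟩
      refine ⟨⟨ObjectProperty.homMk (b ≫ biprod.fst), ObjectProperty.hom_ext _ ?_⟩,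
        ⟨ObjectProperty.homMk (b ≫ biprod.snd), ObjectProperty.hom_ext _ ?_⟩⟩
      · change (b ≫ biprod.fst) ≫ d.hom = (b ≫ biprod.map d.hom d'.hom) ≫ biprod.fst
        simp
      · change (b ≫ biprod.snd) ≫ d'.hom = (b ≫ biprod.map d.hom d'.hom) ≫ biprod.snd
        simp

instance : (isFinitelyPresented 𝒳).IsClosedUnderBinaryProducts where
  limitsOfShape_le := by
    rintro F ⟨p⟩
    refine (isFinitelyPresented 𝒳).prop_of_iso ?_ (isFinitelyPresented_biprod
      (p.prop_diag_obj (.mk .left)) (p.prop_diag_obj (.mk .right)))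
    exact (biprod.isoProd _ _).trans (IsLimit.conePointUniqueUpToIso (prodIsProd _ _)
      ((IsLimit.postcomposeHomEquiv (diagramIsoPair p.diag) _).2 p.isLimit))

instance : (isFinitelyPresented 𝒳).IsClosedUnderFiniteProducts :=
  ObjectProperty.IsClosedUnderFiniteProducts.mk'

/-- Kernels and cokernels in `mod-𝒳` are computed in the category of all functors. -/
instance : Abelian (ModCat 𝒳) := inferInstance

instance : (isFinitelyPresented 𝒳).ι.PreservesHomology where
  preservesKernels _ _ f := (isFinitelyPresented 𝒳).preservesKernels_ι f
  preservesCokernels _ _ f := (isFinitelyPresented 𝒳).preservesCokernels_ι f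

end Abelian

end Functors

section Theta

open Opposite

universe v u

variable {𝒜 : Type u} [Category.{v} 𝒜] [Abelian 𝒜] {𝒳 : ObjectProperty 𝒜}

namespace Presentation

variable {F G H : 𝒳.FullSubcategoryᵒᵖ ⥤ AddCommGrpCat.{v}}

/-- A morphism between the degree zero terms of two presentations lifts `f : F ⟶ G` if it
makes the square with the two augmentations commute. -/
def IsLift (p : Presentation F) (q : Presentation G) (f : F ⟶ G) (g : p.X₀ ⟶ q.X₀) : Prop :=
  preadditiveYoneda.map g ≫ q.π = p.π ≫ f

theorem isLift_iff (p : Presentation F) (q : Presentation G) (f : F ⟶ G) (g : p.X₀ ⟶ q.X₀) :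
    p.IsLift q f g ↔ G.map g.op q.gen = f.app _ p.gen := by
  constructor
  · intro h
    have h' := ConcreteCategory.congr_hom (congrArg (fun t => NatTrans.app t (op p.X₀)) h)
      (show (preadditiveYoneda.obj p.X₀).obj (op p.X₀) from 𝟙 p.X₀)
    refine Eq.trans ?_ h'
    rw [← q.π_apply]
    change _ = q.π.app (op p.X₀) (show (preadditiveYoneda.obj q.X₀).obj (op p.X₀) from 𝟙 _ ≫ g)
    rw [Category.id_comp]
  · intro h
    refine NatTrans.ext (funext fun Y => AddCommGrpCat.ext fun (a : Y.unop ⟶ p.X₀) => ?_)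
    change q.π.app Y (show (preadditiveYoneda.obj q.X₀).obj Y from a ≫ g) =
      f.app Y (p.π.app Y (show (preadditiveYoneda.obj p.X₀).obj Y from a))
    refine (q.π_apply (a ≫ g)).trans (Eq.trans ?_ (congrArg (f.app Y) (p.π_apply a).symm))
    rw [map_comp_op_apply, h]
    exact (ConcreteCategory.congr_hom (f.naturality a.op) p.gen).symm

theorem exists_isLift (p : Presentation F) (q : Presentation G) (f : F ⟶ G) :
    ∃ g : p.X₀ ⟶ q.X₀, p.IsLift q f g := by
  obtain ⟨g, hg⟩ := q.exists_eq (f.app _ p.gen)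
  exact ⟨g, (isLift_iff p q f g).2 hg⟩

theorem map_d_gen (p : Presentation F) : F.map p.d.op p.gen = 0 :=
  (p.map_gen_eq_zero_iff p.d).2 ⟨𝟙 _, Category.id_comp _⟩

theorem IsLift.d_comp {p : Presentation F} {q : Presentation G} {f : F ⟶ G} {g : p.X₀ ⟶ q.X₀}
    (hg : p.IsLift q f g) : p.d.hom ≫ g.hom ≫ cokernel.π q.d.hom = 0 := by
  obtain ⟨h, hh⟩ := (q.map_gen_eq_zero_iff (p.d ≫ g)).1 (by
    rw [map_comp_op_apply, (isLift_iff p q f g).1 hg]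
    refine (ConcreteCategory.congr_hom (f.naturality p.d.op) p.gen).symm.trans ?_
    exact (congrArg (f.app _) p.map_d_gen).trans (map_zero (f.app _).hom))
  have hh' : h.hom ≫ q.d.hom = p.d.hom ≫ g.hom := congrArg (fun t => t.hom) hh
  rw [← Category.assoc, ← hh', Category.assoc, cokernel.condition, comp_zero]

theorem IsLift.unique [G.Additive] {p : Presentation F} {q : Presentation G} {f : F ⟶ G}
    {g g' : p.X₀ ⟶ q.X₀} (hg : p.IsLift q f g) (hg' : p.IsLift q f g') :
    g.hom ≫ cokernel.π q.d.hom = g'.hom ≫ cokernel.π q.d.hom := by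
  obtain ⟨h, hh⟩ := (q.map_gen_eq_zero_iff (g + -g')).1 (by
    have hneg : G.map (-g').op q.gen = - G.map g'.op q.gen := by
      rw [op_neg, G.map_neg]
      rfl
    rw [map_add_op_apply, hneg, (isLift_iff p q f g).1 hg, (isLift_iff p q f g').1 hg',
      add_neg_cancel])
  have hh' : h.hom ≫ q.d.hom = g.hom + -g'.hom := congrArg (fun t => t.hom) hh
  have : (g.hom + -g'.hom) ≫ cokernel.π q.d.hom = 0 := by
    rw [← hh', Category.assoc, cokernel.condition, comp_zero]
  rwa [Preadditive.add_comp, Preadditive.neg_comp, add_neg_eq_zero] at this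

/-- The map induced on cokernels by a lift of `f` to presentations. It does not depend on
the lift, see `π_cokernelMap`. -/
def cokernelMap (p : Presentation F) (q : Presentation G) (f : F ⟶ G) :
    cokernel p.d.hom ⟶ cokernel q.d.hom :=
  cokernel.desc _ ((p.exists_isLift q f).choose.hom ≫ cokernel.π q.d.hom)
    (p.exists_isLift q f).choose_spec.d_comp

theorem π_cokernelMap [G.Additive] {p : Presentation F} {q : Presentation G} {f : F ⟶ G}
    {g : p.X₀ ⟶ q.X₀} (hg : p.IsLift q f g) :
    cokernel.π p.d.hom ≫ cokernelMap p q f = g.hom ≫ cokernel.π q.d.hom :=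
  (cokernel.π_desc _ _ _).trans ((p.exists_isLift q f).choose_spec.unique hg)

end Presentation

/-- A chosen presentation of a finitely presented `𝒳`-module. -/
def presentation (F : ModCat 𝒳) : Presentation F.obj := F.property.2.some

instance (F : ModCat 𝒳) : F.obj.Additive := F.property.1

variable (𝒳)

/-- The functor `ϑ : mod-𝒳 ⥤ 𝒜`. On objects it takes `F`, presented by
`𝒳(-, X₁) ⟶ 𝒳(-, X₀) ⟶ F ⟶ 0`, to the cokernel of `X₁ ⟶ X₀`; on morphisms it is
induced by lifting to the presentations. -/
def theta : ModCat 𝒳 ⥤ 𝒜 where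
  obj F := cokernel (presentation F).d.hom
  map {F G} f := (presentation F).cokernelMap (presentation G) f.hom
  map_id F := by
    rw [← cancel_epi (cokernel.π _), Presentation.π_cokernelMap (g := 𝟙 _)]
    · exact (Category.id_comp _).trans (Category.comp_id _).symm
    · rw [Presentation.IsLift, CategoryTheory.Functor.map_id, Category.id_comp]
      exact (Category.comp_id _).symm
  map_comp {F G H} f f' := by
    obtain ⟨g, hg⟩ := (presentation F).exists_isLift (presentation G) f.hom
    obtain ⟨g', hg'⟩ := (presentation G).exists_isLift (presentation H) f'.hom
    rw [← cancel_epi (cokernel.π _), Presentation.π_cokernelMap (g := g ≫ g'), ← Category.assoc,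
      Presentation.π_cokernelMap hg, Category.assoc, Presentation.π_cokernelMap hg',
      ← Category.assoc]
    · rfl
    · rw [Presentation.IsLift] at hg hg' ⊢
      rw [CategoryTheory.Functor.map_comp, Category.assoc, hg', ← Category.assoc, hg,
        Category.assoc]
      rfl

variable {𝒳}

/-- The projection `X₀ ⟶ ϑ(F)`. -/
def thetaπ (F : ModCat 𝒳) : (presentation F).X₀.obj ⟶ (theta 𝒳).obj F :=
  cokernel.π (presentation F).d.hom

instance (F : ModCat 𝒳) : Epi (thetaπ F) :=
  inferInstanceAs (Epi (cokernel.π (presentation F).d.hom))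

theorem d_thetaπ (F : ModCat 𝒳) : (presentation F).d.hom ≫ thetaπ F = 0 :=
  cokernel.condition _

theorem exact_thetaπ (F : ModCat 𝒳) :
    (ShortComplex.mk (presentation F).d.hom (thetaπ F) (d_thetaπ F)).Exact :=
  ShortComplex.exact_cokernel _

theorem thetaπ_map {F G : ModCat 𝒳} {f : F ⟶ G}
    {g : (presentation F).X₀ ⟶ (presentation G).X₀}
    (hg : (presentation F).IsLift (presentation G) f.hom g) :
    thetaπ F ≫ (theta 𝒳).map f = g.hom ≫ thetaπ G :=
  Presentation.π_cokernelMap hg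

variable [IsContravariantlyFinite 𝒳]

instance : (theta 𝒳).Additive where
  map_add {F G f f'} := by
    obtain ⟨g, hg⟩ := (presentation F).exists_isLift (presentation G) f.hom
    obtain ⟨g', hg'⟩ := (presentation F).exists_isLift (presentation G) f'.hom
    rw [← cancel_epi (thetaπ F), Preadditive.comp_add, thetaπ_map hg,
      thetaπ_map hg', thetaπ_map (g := g + g')]
    · exact Preadditive.add_comp _ _ _ _ _ _
    · rw [Presentation.isLift_iff] at hg hg' ⊢
      rw [map_add_op_apply, hg, hg']
      rfl

end Theta

section Modules

open Opposite

universe u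

variable {Λ : Type u} [Ring Λ]

variable (Λ) in
/-- The category `mod-Λ` of finitely generated right `Λ`-modules, as modules over the opposite
ring. Over an Artin algebra these are the finitely presented ones. -/
abbrev RightMod := FGModuleCat.{u} Λᵐᵒᵖ

theorem finitePresentation_rightMod [IsNoetherianRing Λᵐᵒᵖ] (M : RightMod Λ) :
    Module.FinitePresentation Λᵐᵒᵖ M :=
  Module.finitePresentation_of_finite Λᵐᵒᵖ M

variable (Λ) in
/-- The right module `Λ` is free of rank one over the opposite ring. -/
def regularEquiv : Λᵐᵒᵖ ≃ₗ[Λᵐᵒᵖ] Λ where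
  toFun := MulOpposite.unop
  invFun := MulOpposite.op
  map_add' _ _ := rfl
  map_smul' _ _ := rfl
  left_inv _ := rfl
  right_inv _ := rfl

instance : Module.Finite Λᵐᵒᵖ Λ := Module.Finite.equiv (regularEquiv Λ)

instance : Module.Projective Λᵐᵒᵖ Λ := Module.Projective.of_equiv (regularEquiv Λ)

/-- `𝒳` contains the finitely generated projective modules. -/
class ContainsProjectives (𝒳 : ObjectProperty (RightMod Λ)) : Prop where
  prop_of_projective (P : RightMod Λ) (hP : Module.Projective Λᵐᵒᵖ P) : 𝒳 P

variable (𝒳 : ObjectProperty (RightMod Λ)) [ContainsProjectives 𝒳]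

/-- The right module `Λ` as an object of `𝒳`. -/
def regular : 𝒳.FullSubcategory where
  obj := FGModuleCat.of Λᵐᵒᵖ Λ
  property := ContainsProjectives.prop_of_projective _
    (inferInstanceAs (Module.Projective Λᵐᵒᵖ Λ))

variable {𝒳} in
/-- The map `Λ ⟶ M` that takes `1` to `m`. -/
def ofElement {M : 𝒳.FullSubcategory} (m : M.obj) : regular 𝒳 ⟶ M :=
  ObjectProperty.homMk (ObjectProperty.homMk (ModuleCat.ofHom
    { toFun := fun l : Λ => MulOpposite.op l • m
      map_add' := fun l l' => add_smul (MulOpposite.op l) (MulOpposite.op l') m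
      map_smul' := fun r l => mul_smul r (MulOpposite.op l) m }))

variable {𝒳} in
theorem ofElement_one {M : 𝒳.FullSubcategory} (φ : regular 𝒳 ⟶ M) :
    ofElement (φ.hom.hom.hom (1 : Λ)) = φ := by
  refine ObjectProperty.hom_ext _ (ObjectProperty.hom_ext _ (ModuleCat.hom_ext
    (LinearMap.ext fun (l : Λ) => ?_)))
  change MulOpposite.op l • φ.hom.hom.hom (1 : Λ) = φ.hom.hom.hom l
  exact (φ.hom.hom.hom.map_smul (MulOpposite.op l) (1 : Λ)).symm.trans
    (congrArg φ.hom.hom.hom (one_mul l))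

variable {𝒳} in
theorem ofElement_comp {M N : 𝒳.FullSubcategory} (m : M.obj) (g : M ⟶ N) :
    ofElement m ≫ g = ofElement (g.hom.hom.hom m) := by
  rw [← ofElement_one (ofElement m ≫ g)]
  congr 1
  change g.hom.hom.hom (MulOpposite.op (1 : Λ) • m) = _
  rw [MulOpposite.op_one, one_smul]

variable {𝒳} in
theorem ofElement_add {M : 𝒳.FullSubcategory} (m n : M.obj) :
    ofElement (m + n) = ofElement m + ofElement n :=
  ObjectProperty.hom_ext _ (ObjectProperty.hom_ext _ (ModuleCat.hom_ext
    (LinearMap.ext fun (l : Λ) => smul_add (MulOpposite.op l) m n)))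

variable [IsNoetherianRing Λᵐᵒᵖ] [IsContravariantlyFinite 𝒳]

/-- The evaluation `F ↦ F(Λ)`. -/
def evalRegular : ModCat 𝒳 ⥤ AddCommGrpCat.{u} :=
  (isFinitelyPresented 𝒳).ι ⋙ (evaluation _ _).obj (op (regular 𝒳))

instance : (evalRegular 𝒳).Additive :=
  inferInstanceAs ((isFinitelyPresented 𝒳).ι ⋙ (evaluation _ _).obj (op (regular 𝒳))).Additive

instance : (evalRegular 𝒳).PreservesHomology where
  preservesKernels _ _ f :=
    have := (isFinitelyPresented 𝒳).preservesKernels_ι f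
    inferInstanceAs (PreservesLimit (parallelPair f 0)
    ((isFinitelyPresented 𝒳).ι ⋙ (evaluation _ _).obj (op (regular 𝒳))))
  preservesCokernels _ _ f :=
    have := (isFinitelyPresented 𝒳).preservesCokernels_ι f
    inferInstanceAs (PreservesColimit (parallelPair f 0)
    ((isFinitelyPresented 𝒳).ι ⋙ (evaluation _ _).obj (op (regular 𝒳))))

/-- The underlying abelian group of a finitely generated module. -/
def underlying (Λ : Type u) [Ring Λ] : RightMod Λ ⥤ AddCommGrpCat.{u} :=
  forget₂ (RightMod Λ) (ModuleCat.{u} Λᵐᵒᵖ) ⋙ forget₂ (ModuleCat.{u} Λᵐᵒᵖ) AddCommGrpCat.{u}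

instance : (underlying Λ).Additive where

instance : (underlying Λ).Faithful :=
  inferInstanceAs (forget₂ (RightMod Λ) (ModuleCat.{u} Λᵐᵒᵖ) ⋙
    forget₂ (ModuleCat.{u} Λᵐᵒᵖ) AddCommGrpCat.{u}).Faithful

instance : PreservesFiniteLimits (underlying Λ) :=
  inferInstanceAs (PreservesFiniteLimits (forget₂ (RightMod Λ) (ModuleCat.{u} Λᵐᵒᵖ) ⋙
    forget₂ (ModuleCat.{u} Λᵐᵒᵖ) AddCommGrpCat.{u}))

instance : PreservesFiniteColimits (underlying Λ) :=
  have : PreservesFiniteColimits (forget₂ (ModuleCat.{u} Λᵐᵒᵖ) AddCommGrpCat.{u}) :=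
    PreservesColimits.preservesFiniteColimits.{u, u} _
  comp_preservesFiniteColimits (forget₂ (RightMod Λ) (ModuleCat.{u} Λᵐᵒᵖ)) _

variable {𝒳} in
/-- The map `X₀ ⟶ F(Λ)` given by the chosen presentation. -/
def evalπ (F : ModCat 𝒳) :
    (underlying Λ).obj (presentation F).X₀.obj ⟶ (evalRegular 𝒳).obj F :=
  AddCommGrpCat.ofHom (AddMonoidHom.mk'
    (fun m => F.obj.map (ofElement (M := (presentation F).X₀) m).op (presentation F).gen)
    (fun m n => (congrArg (fun t => F.obj.map (Quiver.Hom.op t) (presentation F).gen)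
      (ofElement_add m n)).trans (map_add_op_apply F.obj _ _ _)))

variable {𝒳} in
theorem evalπ_surjective (F : ModCat 𝒳) : Function.Surjective (evalπ F) := by
  intro z
  obtain ⟨g, hg⟩ := (presentation F).exists_eq (Y := regular 𝒳) z
  refine ⟨g.hom.hom.hom (1 : Λ), Eq.trans ?_ hg⟩
  exact congrArg (fun t => F.obj.map (Quiver.Hom.op t) (presentation F).gen) (ofElement_one g)

variable {𝒳} in
theorem evalπ_exact (F : ModCat 𝒳) :
    Function.Exact ((underlying Λ).map (presentation F).d.hom) (evalπ F) := by
  intro m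
  refine ((presentation F).map_gen_eq_zero_iff
    (ofElement (M := (presentation F).X₀) m)).trans ⟨?_, ?_⟩
  · rintro ⟨h, hh⟩
    refine ⟨h.hom.hom.hom (1 : Λ), ?_⟩
    have := congrArg (fun t => t.hom.hom.hom (1 : Λ)) hh
    refine Eq.trans this ?_
    exact one_smul Λᵐᵒᵖ (show (presentation F).X₀.obj from m)
  · rintro ⟨n, rfl⟩
    exact ⟨ofElement n, ofElement_comp n _⟩

variable {𝒳} in
theorem underlying_thetaπ_surjective (F : ModCat 𝒳) :
    Function.Surjective ((underlying Λ).map (thetaπ F)) :=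
  (AddCommGrpCat.epi_iff_surjective _).1 inferInstance

variable {𝒳} in
theorem underlying_thetaπ_exact (F : ModCat 𝒳) :
    Function.Exact ((underlying Λ).map (presentation F).d.hom)
      ((underlying Λ).map (thetaπ F)) :=
  (ShortComplex.ab_exact_iff_function_exact _).1 ((exact_thetaπ F).map (underlying Λ))

variable {𝒳} in
/-- The isomorphism `ϑ(F) ≃ F(Λ)` of abelian groups. -/
theorem exists_thetaEval (F : ModCat 𝒳) :
    ∃ e : (underlying Λ).obj ((theta 𝒳).obj F) ≅ (evalRegular 𝒳).obj F,
      (underlying Λ).map (thetaπ F) ≫ e.hom = evalπ F := by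
  have h₁ := (exact_thetaπ F).map (underlying Λ)
  have : Epi ((ShortComplex.mk _ _ (d_thetaπ F)).map (underlying Λ)).g :=
    inferInstanceAs (Epi ((underlying Λ).map (thetaπ F)))
  have : Epi (evalπ F) := (AddCommGrpCat.epi_iff_surjective _).2 (evalπ_surjective F)
  have w : (underlying Λ).map (presentation F).d.hom ≫ evalπ F = 0 :=
    AddCommGrpCat.ext fun n => (evalπ_exact F _).2 ⟨n, rfl⟩
  have h₂ : (ShortComplex.mk _ _ w).Exact :=
    (ShortComplex.ab_exact_iff_function_exact _).2 (evalπ_exact F)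
  refine ⟨IsColimit.coconePointUniqueUpToIso h₁.gIsCokernel h₂.gIsCokernel, ?_⟩
  exact IsColimit.comp_coconePointUniqueUpToIso_hom h₁.gIsCokernel h₂.gIsCokernel
    WalkingParallelPair.one

/-- `ϑ(F) ≃ F(Λ)`, naturally in `F`. -/
def thetaEvalIso : theta 𝒳 ⋙ underlying Λ ≅ evalRegular 𝒳 :=
  NatIso.ofComponents (fun F => (exists_thetaEval F).choose) (by
    intro F G f
    obtain ⟨g, hg⟩ := (presentation F).exists_isLift (presentation G) f.hom
    have hF := (exists_thetaEval F).choose_spec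
    have hG := (exists_thetaEval G).choose_spec
    rw [← cancel_epi ((underlying Λ).map (thetaπ F)), ← Category.assoc, ← Category.assoc, hF,
      CategoryTheory.Functor.comp_map, ← CategoryTheory.Functor.map_comp, thetaπ_map hg,
      CategoryTheory.Functor.map_comp, Category.assoc, hG]
    refine AddCommGrpCat.ext fun (m : (presentation F).X₀.obj) => ?_
    change G.obj.map (ofElement (g.hom.hom.hom m)).op (presentation G).gen =
      f.hom.app _ (F.obj.map (ofElement m).op (presentation F).gen)
    rw [← ofElement_comp, map_comp_op_apply, (Presentation.isLift_iff _ _ _ g).1 hg]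
    exact (ConcreteCategory.congr_hom (f.hom.naturality (ofElement m).op) _).symm)

/-- The functor `ϑ` is exact. -/
instance : (theta 𝒳).PreservesHomology :=
  Functor.preservesHomology_of_map_exact _ (fun S hS => by
    have h : (S.map (theta 𝒳 ⋙ underlying Λ)).Exact :=
      (ShortComplex.exact_iff_of_iso (S.mapNatIso (thetaEvalIso 𝒳))).2 (hS.map (evalRegular 𝒳))
    exact (underlying Λ).reflects_exact_of_faithful (S.map (theta 𝒳)) h)

/-- The functor `D^b_ϑ : D^b(mod-𝒳) ⥤ D^b(mod-Λ)`, which applies `ϑ` term by term. -/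
abbrev derivedTheta : Db (ModCat 𝒳) ⥤ Db (RightMod Λ) := mapDb (theta 𝒳)

/-- `D^b_0(mod-𝒳)`, the kernel of `D^b_ϑ`. -/
abbrev kernelDerivedTheta : ObjectProperty (Db (ModCat 𝒳)) := kernelOf (derivedTheta 𝒳)

/-- `K^b_{Λ-ac}(mod-𝒳)`: the bounded complexes `F` over `mod-𝒳` such that the complex `F(Λ)`
of abelian groups is acyclic. -/
abbrev regularAcyclicKb : ObjectProperty (Kb (ModCat 𝒳)) :=
  (HomotopyCategory.subcategoryAcyclic AddCommGrpCat.{u}).inverseImage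
    ((boundedComplexes (ModCat 𝒳)).ι ⋙ (evalRegular 𝒳).mapHomotopyCategory (ComplexShape.up ℤ))

theorem acyclicKb_le_regularAcyclicKb : acyclicKb (ModCat 𝒳) ≤ regularAcyclicKb 𝒳 := by
  rintro ⟨⟨K⟩, hb⟩ hK
  have hK' : K.Acyclic :=
    (HomotopyCategory.quotient_obj_mem_subcategoryAcyclic_iff_acyclic K).1 hK
  refine (HomotopyCategory.quotient_obj_mem_subcategoryAcyclic_iff_acyclic
    (((evalRegular 𝒳).mapHomologicalComplex _).obj K)).2 fun n => ?_
  exact (hK' n).map (evalRegular 𝒳)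

/-- `K^b_ac(mod-𝒳)` inside `K^b_{Λ-ac}(mod-𝒳)`. -/
abbrev acyclicInRegularAcyclic : ObjectProperty (regularAcyclicKb 𝒳).FullSubcategory :=
  (acyclicKb (ModCat 𝒳)).inverseImage (regularAcyclicKb 𝒳).ι

instance : (regularAcyclicKb 𝒳).IsTriangulated := inferInstance

instance : (acyclicInRegularAcyclic 𝒳).IsTriangulated := inferInstance

end Modules

/-- Artin algebras are noetherian on both sides. -/
theorem isNoetherianRing_op (R : Type*) (Λ : Type*) [CommRing R] [IsArtinianRing R] [Ring Λ]
    [Algebra R Λ] [Module.Finite R Λ] : IsNoetherianRing Λᵐᵒᵖ :=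
  have : Module.Finite R Λᵐᵒᵖ := Module.Finite.equiv (MulOpposite.opLinearEquiv R)
  isNoetherian_of_tower R (inferInstance : IsNoetherian R Λᵐᵒᵖ)

end DerivedAuslander

end

open CategoryTheory CategoryTheory.Limits CategoryTheory.Pretriangulated ZeroObject

namespace DerivedAuslander

universe v u

/-! The theorem is an instance of a general fact about subquotients: if `N ⊆ M` are triangulated
subcategories of `T` and `M` consists of exactly those objects whose image in `T/N` lies in `P`,
then `M/N` is `P`. The functor `M/N ⥤ T/N` is fully faithful because `M` contains `N`: a fraction
between objects of `M` passes through an object that differs from one of them by a cone in `N ⊆ M`,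
so up to isomorphism it never leaves `M`. It reaches every object of `P`, because each object of
`T/N` comes from `T`. This is `exists_equivalence_subquotient`.

Here `T` is the bounded homotopy category of `mod-𝒳`, `N` consists of the acyclic complexes, `M` of
those that are acyclic at `Λ`, and `P` is the kernel of the derived functor of `ϑ`. What remains is
to recognise `M` as the preimage of `P`, which is `kernelDerivedTheta_quotientFunctor_obj_iff`. A
complex goes to zero in `D^b(mod-Λ)` under `ϑ` if and only if its termwise image is acyclic
(`isZero_quotientFunctor_obj_iff`). As an abelian group `ϑ(F)` is `F(Λ)`, naturally in `F`: since
`Hom(Λ, X) = X`, evaluating a presentation of `F` at `Λ` exhibits `F(Λ)` as the cokernel that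
defines `ϑ(F)`. Exactness of modules is detected on underlying groups, so acyclicity after `ϑ` is
acyclicity at `Λ`. -/

/-- Every subcategory that contains `N` is right `N`-localizing. -/
theorem isVerdierRightLocalizing_of_le {T : Type u} [Category.{v} T] {M N : ObjectProperty T}
    (h : N ≤ M) : M.IsVerdierRightLocalizing N where
  -- The source lies in `N`, hence in `M` as well, so it can itself serve as the intermediate
  -- object.
  fac {X _} f hX _ := ⟨X, 𝟙 X, f, h _ hX, hX, Category.id_comp f⟩

/-! ### Subquotients of a triangulated category -/

section Subquotient

variable {T : Type u} [Category.{v} T] [HasZeroObject T] [HasShift T ℤ] [Preadditive T]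
  [∀ n : ℤ, (shiftFunctor T n).Additive] [Pretriangulated T] [IsTriangulated T]

/-- If `N ⊆ M` are triangulated subcategories of `T` and `M` is the preimage of a triangulated
subcategory `P` of `T/N`, then `M/N` is equivalent to `P`. -/
theorem exists_equivalence_subquotient (M N : ObjectProperty T) [M.IsTriangulated]
    [N.IsTriangulated] [N.IsClosedUnderIsomorphisms] (hNM : N ≤ M)
    (P : ObjectProperty (VerdierQuotient N)) [P.IsTriangulated]
    [P.IsClosedUnderIsomorphisms]
    (hP : ∀ X, P ((quotientFunctor N).obj X) ↔ M X) :
    ∃ (E : VerdierQuotient (N.inverseImage M.ι) ≌ P.FullSubcategory)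
      (_ : E.functor.CommShift ℤ), E.functor.IsTriangulated ∧
      ∃ e : quotientFunctor (N.inverseImage M.ι) ⋙ E.functor ⋙ P.ι ≅
          M.ι ⋙ quotientFunctor N, NatTrans.CommShift e.hom ℤ := by
  have := isVerdierRightLocalizing_of_le hNM
  let L := quotientFunctor (N.inverseImage M.ι)
  let W := (N.inverseImage M.ι).trW
  let F : VerdierQuotient (N.inverseImage M.ι) ⥤ VerdierQuotient N :=
    Localization.lift (M.ι ⋙ quotientFunctor N)
      (ObjectProperty.inverseImage_trW_isInverted N M.ι (quotientFunctor N)) L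
  let : Localization.Lifting L W (M.ι ⋙ quotientFunctor N) F :=
    Localization.liftingLift _ _ _
  let iso : L ⋙ F ≅ M.ι ⋙ quotientFunctor N := Localization.Lifting.iso L W _ _
  let : F.CommShift ℤ := Functor.commShiftOfLocalization L W ℤ (M.ι ⋙ quotientFunctor N) F
  have hiso : NatTrans.CommShift iso.hom ℤ :=
    NatTrans.commShift_iso_hom_of_localization L W ℤ _ F
  -- Every morphism of `M/N` is isomorphic to the image of one in `M`, so every distinguished
  -- triangle comes from `M` up to isomorphism. Hence exactness of `F` can be tested after composing
  -- with `L`.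
  have : L.mapArrow.EssSurj := Localization.essSurj_mapArrow _ W
  have : F.IsTriangulated := Functor.isTriangulated_of_precomp_iso iso
  -- The inclusion `N ≤ M` enters here, through the right localizing property.
  let hF : F.FullyFaithful := ObjectProperty.IsVerdierRightLocalizing.fullyFaithful M N iso
  have := hF.full
  have := hF.faithful
  have : L.EssSurj := Localization.essSurj L W
  have : (quotientFunctor N).EssSurj := Localization.essSurj _ N.trW
  -- Each object of `M/N` is isomorphic to the image of an object of `M`, where `hP` applies;
  -- closure of `P` under isomorphisms does the rest.
  have hFP (X) : P (F.obj X) :=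
    P.prop_of_iso ((iso.app (L.objPreimage X)).symm ≪≫ F.mapIso (L.objObjPreimageIso X))
      ((hP _).2 (L.objPreimage X).property)
  let G := P.lift F hFP
  -- A preimage in `T` of an object of `P` lies in `M` by the other direction of `hP`, so it already
  -- defines an object of `M/N`.
  have : G.EssSurj := ⟨fun Y => by
    let e := (quotientFunctor N).objObjPreimageIso Y.obj
    refine ⟨L.obj ⟨(quotientFunctor N).objPreimage Y.obj,
      (hP _).1 (P.prop_of_iso e.symm Y.property)⟩, ⟨P.isoMk (iso.app _ ≪≫ e)⟩⟩⟩
  have : G.IsEquivalence := { }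
  let e : L ⋙ G ⋙ P.ι ≅ M.ι ⋙ quotientFunctor N :=
    Functor.isoWhiskerLeft L (P.liftCompιIso F hFP) ≪≫ iso
  -- This is the forward map of `e`, written as a composite of two transformations that are each
  -- known to commute with the shifts.
  have he : NatTrans.CommShift (Functor.whiskerLeft L (P.liftCompιIso F hFP).hom ≫ iso.hom) ℤ :=
    inferInstance
  let hG : G.CommShift ℤ := inferInstance
  have hG' : G.IsTriangulated := inferInstance
  exact ⟨G.asEquivalence, hG, hG', e, he⟩

end Subquotient

/-! ### Kernels of functors and vanishing in the bounded derived category -/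

instance {T : Type*} [Category* T] {T' : Type*} [Category* T'] (Φ : T ⥤ T') :
    (kernelOf Φ).IsClosedUnderIsomorphisms where
  of_iso e h := h.of_iso (Φ.mapIso e.symm)

/-- A bounded complex vanishes in the derived category if and only if it is acyclic. -/
theorem isZero_quotientFunctor_obj_iff {A : Type u} [Category.{v} A] [Abelian A] (K : Kb A) :
    IsZero ((quotientFunctor (acyclicKb A)).obj K) ↔ acyclicKb A K := by
  constructor
  · intro h
    -- In a zero object the identity equals zero. By the calculus of fractions the identity and zero
    -- of `K` then agree after some `s : K ⟶ L` with acyclic cone, which forces `s = 0`.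
    obtain ⟨L, s, hs, hs0⟩ := (MorphismProperty.map_eq_iff_postcomp
      (quotientFunctor (acyclicKb A)) (acyclicKb A).trW (𝟙 K) 0).1 (h.eq_of_src _ _)
    rw [Category.id_comp, zero_comp] at hs0
    subst hs0
    -- In the unbounded homotopy category, having an acyclic cone means being a quasi-isomorphism.
    -- So zero induces isomorphisms from the homology of `K`, and that homology vanishes.
    rw [ObjectProperty.inverseImage_trW_iff,
      ← HomotopyCategory.quasiIso_eq_trW_subcategoryAcyclic,
      HomotopyCategory.mem_quasiIso_iff] at hs
    refine (HomotopyCategory.mem_subcategoryAcyclic_iff _).2 fun n => ?_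
    have := hs n
    rw [Functor.map_zero, Functor.map_zero] at this
    exact IsZero.of_mono_eq_zero _ (rfl : (0 : (HomotopyCategory.homologyFunctor A _ n).obj _ ⟶
      (HomotopyCategory.homologyFunctor A _ n).obj L.obj) = 0)
  · intro h
    -- The triangle `K ⟶ K ⟶ 0` starting with the identity has the acyclic `K` as the fibre of `K ⟶
    -- 0`, so this map becomes invertible in the quotient.
    have h0 : (acyclicKb A).trW (0 : K ⟶ 0) :=
      (ObjectProperty.trW_iff' _ _).2 ⟨K, 𝟙 K, 0, contractible_distinguished K, h⟩
    have := Localization.inverts (quotientFunctor (acyclicKb A)) (acyclicKb A).trW _ h0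
    exact (Functor.map_isZero _ (isZero_zero _)).of_iso
      (asIso ((quotientFunctor (acyclicKb A)).map (0 : K ⟶ 0)))

/-! ### Acyclicity after `ϑ` and acyclicity at `Λ` -/

section Modules

variable {Λ : Type u} [Ring Λ] (𝒳 : ObjectProperty (RightMod Λ)) [ContainsProjectives 𝒳]
  [IsNoetherianRing Λᵐᵒᵖ] [IsContravariantlyFinite 𝒳]

/-- The forgetful functor to abelian groups is exact and faithful, so it both preserves and reflects
exactness; its composite with `ϑ` is evaluation at `Λ` by `thetaEvalIso`. -/
theorem exact_map_theta_iff (S : ShortComplex (ModCat 𝒳)) :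
    (S.map (theta 𝒳)).Exact ↔ (S.map (evalRegular 𝒳)).Exact :=
  ((S.map (theta 𝒳)).exact_map_iff_of_faithful (underlying Λ)).symm.trans
    (ShortComplex.exact_iff_of_iso (S.mapNatIso (thetaEvalIso 𝒳)))

theorem acyclicKb_mapKb_theta_iff (K : Kb (ModCat 𝒳)) :
    acyclicKb (RightMod Λ) ((mapKb (theta 𝒳)).obj K) ↔ regularAcyclicKb 𝒳 K := by
  obtain ⟨⟨K⟩, _⟩ := K
  refine (HomotopyCategory.quotient_obj_mem_subcategoryAcyclic_iff_acyclic
    (((theta 𝒳).mapHomologicalComplex _).obj K)).trans (Iff.trans ?_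
      (HomotopyCategory.quotient_obj_mem_subcategoryAcyclic_iff_acyclic
        (((evalRegular 𝒳).mapHomologicalComplex _).obj K)).symm)
  -- Acyclicity is exactness in each degree, and the degree `n` short complex of a termwise image is
  -- by definition the image of `K.sc n`.
  exact forall_congr' fun n => exact_map_theta_iff 𝒳 (K.sc n)

/-- This identifies the complexes acyclic at `Λ` as the preimage of the kernel, the hypothesis that
the subquotient theorem needs. The derived functor is computed termwise by `mapDbFactors`, so its
vanishing is acyclicity of the image complex. -/
theorem kernelDerivedTheta_quotientFunctor_obj_iff (K : Kb (ModCat 𝒳)) :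
    kernelDerivedTheta 𝒳 ((quotientFunctor (acyclicKb (ModCat 𝒳))).obj K) ↔
      regularAcyclicKb 𝒳 K :=
  (((mapDbFactors (theta 𝒳)).app K).isZero_iff.trans
    (isZero_quotientFunctor_obj_iff _)).trans (acyclicKb_mapKb_theta_iff 𝒳 K)

end Modules

end DerivedAuslander

theorem corollary3p2 {R Λ : Type*} [CommRing R] [IsArtinianRing R] [Ring Λ]
    [Algebra R Λ] [Module.Finite R Λ] (𝒳 : ObjectProperty (DerivedAuslander.RightMod Λ))
    [DerivedAuslander.IsContravariantlyFinite 𝒳] [DerivedAuslander.ContainsProjectives 𝒳] :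
    haveI : IsNoetherianRing Λᵐᵒᵖ := DerivedAuslander.isNoetherianRing_op R Λ
    ∃ (E : DerivedAuslander.VerdierQuotient (DerivedAuslander.acyclicInRegularAcyclic 𝒳) ≌
          (DerivedAuslander.kernelDerivedTheta 𝒳).FullSubcategory)
        (_ : E.functor.CommShift ℤ),
      E.functor.IsTriangulated ∧
      ∃ e : DerivedAuslander.quotientFunctor (DerivedAuslander.acyclicInRegularAcyclic 𝒳) ⋙
            E.functor ⋙ (DerivedAuslander.kernelDerivedTheta 𝒳).ι ≅
          (DerivedAuslander.regularAcyclicKb 𝒳).ι ⋙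
            DerivedAuslander.quotientFunctor
              (DerivedAuslander.acyclicKb (DerivedAuslander.ModCat 𝒳)),
        NatTrans.CommShift e.hom ℤ := by
  have : IsNoetherianRing Λᵐᵒᵖ := DerivedAuslander.isNoetherianRing_op R Λ
  -- The two placeholders are `N`, the acyclic complexes, and `P`, the kernel of the derived functor
  -- of `ϑ`.
  exact DerivedAuslander.exists_equivalence_subquotient
    (DerivedAuslander.regularAcyclicKb 𝒳) _
    (DerivedAuslander.acyclicKb_le_regularAcyclicKb 𝒳) _
    (DerivedAuslander.kernelDerivedTheta_quotientFunctor_obj_iff 𝒳)
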